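/- Let $G$ be a finite group, and let $\Omega(G)=\mathbb{Q}\otimes_{\mathbb{Z}}\Omega_{\mathbb{Z}}(G)$ be its rational Burnside ring, where $\Omega_{\mathbb{Z}}(G)$ is the Grothendieck ring of finite left $G$-sets under disjoint union and product; write $[X]\in\Omega(G)$ for the class of a finite $G$-set $X$. For a finite category $\mathsf{D}$ with a (strict) $G$-action and $n\ge 0$, let $\mathsf{D}_n$ be the finite $G$-set of nondegenerate $n$-simplices of the nerve of $\mathsf{D}$, i.e. of chains $x_0\to x_1\to\cdots\to x_n$ of $n$ composable morphisms of $\mathsf{D}$ none of which is an identity, and put $f_{\mathsf{D}}(t)=\sum_{n\ge0}[\mathsf{D}_n]\,t^n\in\Omega(G)[[t]]$. Let $\mathbb{Q}[t]_{(t+1)}$ be the localization of $\mathbb{Q}[t]$ at the prime ideal $(t+1)$. One says that $\mathsf{D}$ has series Lefschetz invariant if $f_{\mathsf{D}}$ lies in $\Omega(G)\otimes_{\mathbb{Q}}\mathbb{Q}[t]_{(t+1)}$ (both being regarded inside the Laurent series $\Omega(G)((t))$), and in that case the series Lefschetz invariant is $\Lambda_\Sigma(\mathsf{D}):=f_{\mathsf{D}}(-1)\in\Omega(G)$.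 Let $\mathcal{S}$ be any set of subgroups of $G$ that is closed under conjugation. The orbit category $\mathcal{O}_{\mathcal{S}}$ has object set $\mathcal{S}$, and its morphisms $H\to K$ are the $G$-maps $G/H\to G/K$. The subgroup decomposition category $E\mathcal{O}_{\mathcal{S}}$ is the Grothendieck construction of the inclusion $H\mapsto G/H$ of $\mathcal{O}_{\mathcal{S}}$ into finite $G$-sets: its objects are the pairs $(H,a)$ with $H\in\mathcal{S}$ and $a\in G/H$, its morphisms $(H,a)\to(K,b)$ are the $G$-maps $\varphi\colon G/H\to G/K$ with $\varphi(a)=b$, and $g\in G$ acts by $(H,a)\mapsto(H,ga)$ on objects and by sending the morphism $\varphi\colon(H,a)\to(K,b)$ to $\varphi\colon(H,ga)\to(K,gb)$. Then the $G$-category $E\mathcal{O}_{\mathcal{S}}$ has series Lefschetz invariant, and $$\Lambda_\Sigma(E\mathcal{O}_{\mathcal{S}})=\sum_{H\in\mathcal{S}}\frac{-\mu_{\mathcal{S}_+}(H,\infty)}{|G:H|}\,[G/H]\in\Omega(G),$$ where $\mathcal{S}_+$ is the poset obtained from $\mathcal{S}$ (ordered by inclusion) by adjoining a unique maximum element $\infty$,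 and $\mu_{\mathcal{S}_+}$ is its Möbius function. -/

import Mathlib

open CategoryTheory
open scoped TensorProduct Pointwise Polynomial

universe u

noncomputable section

/-! ### Finite `G`-sets -/

/-- A finite (left) `G`-set. -/
structure FinGSet (G : Type u) [Group G] where
  carrier : Type u
  [finite : Finite carrier]
  [action : MulAction G carrier]

namespace FinGSet

variable {G : Type u} [Group G]

attribute [instance] FinGSet.finite FinGSet.action

/-- Bundle a finite `G`-set. -/
def of (G : Type u) [Group G] (X : Type u) [Finite X] [MulAction G X] : FinGSet G := ⟨X⟩

/-- The category of finite `G`-sets and `G`-maps. -/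
instance : Category (FinGSet G) where
  Hom X Y := X.carrier →[G] Y.carrier
  id X := MulActionHom.id G
  comp f g := MulActionHom.comp g f

/-- The underlying set functor. -/
def forget (G : Type u) [Group G] : FinGSet G ⥤ Type u where
  obj X := X.carrier
  map f := ↾(MulActionHom.toFun f)

/-- Disjoint union of finite `G`-sets. -/
def sum (X Y : FinGSet G) : FinGSet G where
  carrier := X.carrier ⊕ Y.carrier
  action :=
    { smul := fun g => Sum.map (g • ·) (g • ·)
      one_smul := by
        rintro (x | y)
        · exact congrArg Sum.inl (one_smul G x)
        · exact congrArg Sum.inr (one_smul G y)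
      mul_smul := by
        rintro g h (x | y)
        · exact congrArg Sum.inl (mul_smul g h x)
        · exact congrArg Sum.inr (mul_smul g h y) }

/-- Product of finite `G`-sets, with the diagonal action. -/
def prod (X Y : FinGSet G) : FinGSet G where
  carrier := X.carrier × Y.carrier

/-- The one-point `G`-set. -/
def point (G : Type u) [Group G] : FinGSet G where
  carrier := PUnit.{u + 1}
  action := { smul := fun _ x => x, one_smul := fun _ => rfl, mul_smul := fun _ _ _ => rfl }

/-- Two `G`-sets are isomorphic if there is a `G`-equivariant bijection between them. -/
instance isoSetoid (G : Type u) [Group G] : Setoid (FinGSet G) where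
  r X Y := ∃ e : X.carrier ≃ Y.carrier, ∀ (g : G) (x : X.carrier), e (g • x) = g • e x
  iseqv :=
    { refl := fun X => ⟨Equiv.refl _, fun _ _ => rfl⟩
      symm := by
        rintro X Y ⟨e, he⟩
        refine ⟨e.symm, fun g y => ?_⟩
        rw [Equiv.symm_apply_eq, he, Equiv.apply_symm_apply]
      trans := by
        rintro X Y Z ⟨e, he⟩ ⟨e', he'⟩
        refine ⟨e.trans e', fun g x => ?_⟩
        simp [he, he'] }

end FinGSet

/-! ### The Burnside ring -/

/-- Isomorphism classes of finite `G`-sets. -/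
def FinGSetClass (G : Type u) [Group G] : Type (u + 1) := Quotient (FinGSet.isoSetoid G)

/-- Isomorphism classes of finite `G`-sets form a commutative monoid under the product. -/
instance (G : Type u) [Group G] : CommMonoid (FinGSetClass G) where
  mul := Quotient.map₂ FinGSet.prod (by
    rintro X X' ⟨e, he⟩ Y Y' ⟨e', he'⟩
    exact ⟨Equiv.prodCongr e e', fun g x => Prod.ext (he g x.1) (he' g x.2)⟩)
  one := Quotient.mk _ (FinGSet.point G)
  mul_assoc := by
    rintro ⟨X⟩ ⟨Y⟩ ⟨Z⟩
    exact Quotient.sound ⟨Equiv.prodAssoc _ _ _, fun _ _ => rfl⟩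
  one_mul := by
    rintro ⟨X⟩
    exact Quotient.sound ⟨Equiv.punitProd _, fun _ _ => rfl⟩
  mul_one := by
    rintro ⟨X⟩
    exact Quotient.sound ⟨Equiv.prodPUnit _, fun _ _ => rfl⟩
  mul_comm := by
    rintro ⟨X⟩ ⟨Y⟩
    exact Quotient.sound ⟨Equiv.prodComm _ _, fun _ _ => rfl⟩

/-- The integral Burnside ring: the Grothendieck ring of finite `G`-sets. It is generated by the
isomorphism classes of finite `G`-sets, with multiplication induced by the product, subject to the
relations `[X ⊔ Y] = [X] + [Y]` (the additive span of these relations is already an ideal, since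
products distribute over disjoint unions). -/
abbrev IntBurnsideRing (G : Type u) [Group G] : Type (u + 1) :=
  MonoidAlgebra ℤ (FinGSetClass G) ⧸
    Ideal.span (Set.range fun P : FinGSet G × FinGSet G =>
      MonoidAlgebra.of ℤ (FinGSetClass G) (Quotient.mk _ (P.1.sum P.2))
        - MonoidAlgebra.of ℤ (FinGSetClass G) (Quotient.mk _ P.1)
        - MonoidAlgebra.of ℤ (FinGSetClass G) (Quotient.mk _ P.2))

/-- The rational Burnside ring `Ω(G)`. -/
abbrev BurnsideRing (G : Type u) [Group G] : Type (u + 1) := ℚ ⊗[ℤ] IntBurnsideRing G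

/-- The class `[X] ∈ Ω(G)` of a finite `G`-set `X`. -/
def burnsideClass {G : Type u} [Group G] (X : FinGSet G) : BurnsideRing G :=
  (1 : ℚ) ⊗ₜ[ℤ] (Ideal.Quotient.mk _ (MonoidAlgebra.of ℤ (FinGSetClass G) (Quotient.mk _ X)))

/-! ### `G`-categories and their nondegenerate simplices -/

/-- A `G`-category: a small category with a strict (left) action of `G` by functors, i.e. a monoid
homomorphism `D.ρ` from `G` to the endofunctors of `D.V`. -/
abbrev GCategory (G : Type u) [Group G] : Type (u + 1) := Action Cat.{u, u} G

/-- A category is finite if it has finitely many objects and finite hom-sets. -/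
class IsFiniteCat (C : Type u) [Category.{u} C] : Prop where
  finite_obj : Finite C
  finite_hom : ∀ x y : C, Finite (x ⟶ y)

namespace GCategory

variable {G : Type u} [Group G]

/-- The action of `g ∈ G` on a `G`-category, as a functor. -/
abbrev act (D : GCategory G) (g : G) : D.V ⥤ D.V := Cat.Hom.toFunctor (D.ρ g)

theorem act_one (D : GCategory G) : D.act 1 = 𝟭 D.V := by
  unfold act
  rw [map_one]
  rfl

theorem act_mul (D : GCategory G) (g h : G) : D.act (g * h) = D.act h ⋙ D.act g := by
  unfold act
  rw [map_mul]
  rfl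

/-- The set `D_n` of nondegenerate `n`-simplices of the nerve of `D`: chains of `n` composable
morphisms `x₀ ⟶ x₁ ⟶ ⋯ ⟶ xₙ`, none of which is an identity morphism. -/
def Simplex (D : GCategory G) (n : ℕ) : Type u :=
  {σ : ComposableArrows D.V n //
    ∀ (i : ℕ) (hi : i < n), ¬ ∃ h : σ.obj' i = σ.obj' (i + 1), σ.map' i (i + 1) = eqToHom h}

theorem eq_eqToHom_of_act (D : GCategory G) (g : G) {x y : D.V} (f : x ⟶ y)
    (H : ∃ h : (D.act g).obj x = (D.act g).obj y, (D.act g).map f = eqToHom h) :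
    ∃ h : x = y, f = eqToHom h := by
  have key : D.act g ⋙ D.act g⁻¹ = 𝟭 D.V := by
    rw [← act_mul, inv_mul_cancel, act_one]
  obtain ⟨h, hf⟩ := H
  have hxy : x = y := by
    have := congrArg (D.act g⁻¹).obj h
    rwa [← Functor.comp_obj, ← Functor.comp_obj, key] at this
  subst hxy
  refine ⟨rfl, ?_⟩
  have h2 := Functor.congr_hom key f
  rw [Functor.comp_map, hf] at h2
  rw [CategoryTheory.Functor.id_map, eqToHom_refl, CategoryTheory.Functor.map_id] at h2
  have h3 := (congrArg (fun k => eqToHom (Functor.congr_obj key x).symm ≫ k ≫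
    eqToHom (Functor.congr_obj key x)) h2).symm
  simpa using h3

/-- `G` acts on the nondegenerate `n`-simplices by translating chains. -/
instance (D : GCategory G) (n : ℕ) : MulAction G (D.Simplex n) where
  smul g σ := ⟨σ.1 ⋙ D.act g, fun i hi h => σ.2 i hi (D.eq_eqToHom_of_act g _ h)⟩
  one_smul σ := Subtype.ext (show σ.1 ⋙ D.act 1 = σ.1 by rw [act_one]; rfl)
  mul_smul g h σ := Subtype.ext
    (show σ.1 ⋙ D.act (g * h) = (σ.1 ⋙ D.act h) ⋙ D.act g by rw [act_mul]; rfl)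

instance (D : GCategory G) [IsFiniteCat D.V] (n : ℕ) : Finite (D.Simplex n) := by
  have := IsFiniteCat.finite_obj (C := D.V)
  have := IsFiniteCat.finite_hom (C := D.V)
  let Φ : ComposableArrows D.V n →
      Σ x : Fin (n + 1) → D.V, ∀ p : {p : Fin (n + 1) × Fin (n + 1) // p.1 ≤ p.2},
        (x p.1.1 ⟶ x p.1.2) :=
    fun σ => ⟨σ.obj, fun p => σ.map (homOfLE p.2)⟩
  have hΦ : Function.Injective Φ := by
    rintro σ τ h
    obtain ⟨h1, h2⟩ := Sigma.mk.inj h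
    refine CategoryTheory.Functor.hext (congrFun h1) fun x y f => ?_
    have key : ∀ (o : Fin (n + 1) → D.V)
        (m : ∀ p : {p : Fin (n + 1) × Fin (n + 1) // p.1 ≤ p.2}, (o p.1.1 ⟶ o p.1.2)),
        σ.obj = o → HEq (fun p : {p : Fin (n + 1) × Fin (n + 1) // p.1 ≤ p.2} =>
          σ.map (homOfLE p.2)) m → HEq (σ.map f) (m ⟨(x, y), leOfHom f⟩) := by
      rintro o m rfl hm
      obtain rfl := eq_of_heq hm
      rfl
    exact key _ _ h1 h2
  have := Finite.of_injective Φ hΦ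
  exact inferInstanceAs (Finite {σ : ComposableArrows D.V n // _})

/-- The formal power series `f_D(t) = ∑ₙ [D_n] tⁿ ∈ Ω(G)[[t]]`. -/
def powerSeries (D : GCategory G) [IsFiniteCat D.V] : PowerSeries (BurnsideRing G) :=
  PowerSeries.mk fun n => burnsideClass (FinGSet.of G (D.Simplex n))

end GCategory

/-! ### The localization `ℚ[t]_{(t+1)}` and evaluation at `-1` -/

/-- The ideal `(t + 1)` of `ℚ[t]`. -/
def idealTAddOne : Ideal ℚ[X] := Ideal.span {Polynomial.X + 1}

theorem mem_idealTAddOne (p : ℚ[X]) : p ∈ idealTAddOne ↔ p.eval (-1) = 0 := by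
  rw [idealTAddOne, Ideal.mem_span_singleton, ← Polynomial.IsRoot.def,
    ← Polynomial.dvd_iff_isRoot]
  simp

instance : idealTAddOne.IsPrime where
  ne_top' := fun h => by
    have := (mem_idealTAddOne 1).1 (h ▸ Submodule.mem_top)
    simp at this
  mem_or_mem' := by
    intro p q h
    simpa [mem_idealTAddOne] using h

/-- The local ring `ℚ[t]_{(t+1)}` of rational functions without a pole at `-1`. -/
abbrev RatAtNegOne : Type := Localization.AtPrime idealTAddOne

theorem isUnit_eval_negOne (q : idealTAddOne.primeCompl) :
    IsUnit ((Polynomial.aeval (R := ℚ) (-1 : ℚ)) (q : ℚ[X])) := by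
  have h : (q : ℚ[X]) ∉ idealTAddOne := q.2
  rw [mem_idealTAddOne] at h
  simpa [Polynomial.aeval_def] using h

/-- Evaluation at `t = -1`, as a `ℚ`-algebra homomorphism `ℚ[t]_{(t+1)} → ℚ`. -/
def evalNegOne : RatAtNegOne →ₐ[ℚ] ℚ :=
  IsLocalization.liftAlgHom (M := idealTAddOne.primeCompl)
    (f := Polynomial.aeval (R := ℚ) (-1 : ℚ)) isUnit_eval_negOne

/-- The inclusion of polynomials into Laurent series. -/
def polyToLaurent : ℚ[X] →+* LaurentSeries ℚ :=
  (HahnSeries.ofPowerSeries ℤ ℚ).comp Polynomial.coeToPowerSeries.ringHom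

theorem polyToLaurent_injective : Function.Injective polyToLaurent := by
  intro p q h
  have h1 : HahnSeries.ofPowerSeries ℤ ℚ (p : PowerSeries ℚ)
      = HahnSeries.ofPowerSeries ℤ ℚ (q : PowerSeries ℚ) := h
  exact Polynomial.coe_injective ℚ (HahnSeries.ofPowerSeries_injective h1)

theorem isUnit_polyToLaurent (q : idealTAddOne.primeCompl) :
    IsUnit (polyToLaurent (q : ℚ[X])) := by
  rw [isUnit_iff_ne_zero]
  intro h
  have h0 : (q : ℚ[X]) = 0 := polyToLaurent_injective (by rw [h, map_zero])
  exact q.2 (h0 ▸ idealTAddOne.zero_mem)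

/-- The canonical embedding of `ℚ[t]_{(t+1)}` into the field of Laurent series. -/
def ratToLaurent : RatAtNegOne →+* LaurentSeries ℚ :=
  IsLocalization.lift (M := idealTAddOne.primeCompl) isUnit_polyToLaurent

theorem ratToLaurent_coeff_smul (c : ℚ) (r : RatAtNegOne) (n : ℤ) :
    (ratToLaurent (c • r)).coeff n = c * (ratToLaurent r).coeff n :=
  map_rat_smul ((HahnSeries.coeff.addMonoidHom (R := ℚ) n).comp
    ratToLaurent.toAddMonoidHom) c r

/-- The canonical map `A ⊗ ℚ[t]_{(t+1)} → A((t))`, `a ⊗ r ↦ a r(t)`, for a `ℚ`-algebra `A`. -/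
def tensorToLaurent (A : Type*) [CommRing A] [Algebra ℚ A] :
    A ⊗[ℚ] RatAtNegOne →ₗ[ℚ] LaurentSeries A :=
  TensorProduct.lift (LinearMap.mk₂ ℚ
    (fun a r => HahnSeries.map (ratToLaurent r) (LinearMap.toSpanSingleton ℚ A a))
    (fun a b r => by ext n; simp)
    (fun c a r => by ext n; exact smul_comm _ _ _)
    (fun a r s => by ext n; simp [add_smul])
    (fun c a r => by ext n; simp [ratToLaurent_coeff_smul, mul_smul]))

theorem ratToLaurent_injective : Function.Injective ratToLaurent :=
  (IsLocalization.lift_injective_iff (M := idealTAddOne.primeCompl)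
    (S := RatAtNegOne) isUnit_polyToLaurent).2 fun p q => by
      rw [polyToLaurent_injective.eq_iff, (IsLocalization.injective RatAtNegOne
        idealTAddOne.primeCompl_le_nonZeroDivisors).eq_iff]

theorem tensorToLaurent_injective (A : Type*) [CommRing A] [Algebra ℚ A] :
    Function.Injective (tensorToLaurent A) := by
  classical
  rw [injective_iff_map_eq_zero]
  intro F hF
  let b := Module.Basis.ofVectorSpace ℚ A
  let e := TensorProduct.equivFinsuppOfBasisLeft (M := A) (N := RatAtNegOne) b
  have key : ∀ (F : A ⊗[ℚ] RatAtNegOne) i (n : ℤ),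
      (ratToLaurent (e F i)).coeff n = b.coord i ((tensorToLaurent A F).coeff n) := by
    intro F i n
    induction F with
    | zero => simp
    | add x y hx hy => simp only [map_add, Finsupp.add_apply, HahnSeries.coeff_add, hx, hy]
    | tmul a r =>
      have h1 : e (a ⊗ₜ r) i = b.coord i a • r := by
        simp [e]
      have h2 : (tensorToLaurent A (a ⊗ₜ r)).coeff n = (ratToLaurent r).coeff n • a := rfl
      rw [h1, h2, ratToLaurent_coeff_smul, map_smul, smul_eq_mul, mul_comm]
  apply e.injective
  rw [map_zero]
  ext i
  apply ratToLaurent_injective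
  ext n
  rw [key, hF]
  simp

/-- Evaluation at `t = -1`, as a map `A ⊗ ℚ[t]_{(t+1)} → A`. -/
def tensorEval (A : Type*) [CommRing A] [Algebra ℚ A] : A ⊗[ℚ] RatAtNegOne →ₗ[ℚ] A :=
  TensorProduct.lift (LinearMap.mk₂ ℚ (fun a r => evalNegOne r • a)
    (fun a b r => smul_add _ _ _)
    (fun c a r => smul_comm _ _ _)
    (fun a r s => by rw [map_add, add_smul])
    (fun c a r => by rw [map_smul, smul_eq_mul, mul_smul]))

/-! ### The series Lefschetz invariant -/

namespace GCategory

variable {G : Type u} [Group G]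

/-- `F ∈ Ω(G) ⊗ ℚ[t]_{(t+1)}` represents `f_D` if both have the same Laurent expansion. -/
def Represents (D : GCategory G) [IsFiniteCat D.V] (F : BurnsideRing G ⊗[ℚ] RatAtNegOne) : Prop :=
  tensorToLaurent (BurnsideRing G) F = HahnSeries.ofPowerSeries ℤ (BurnsideRing G) D.powerSeries

/-- `D` has series Lefschetz invariant if `f_D` lies in `Ω(G) ⊗ ℚ[t]_{(t+1)}`. -/
def HasSeriesLefschetzInvariant (D : GCategory G) [IsFiniteCat D.V] : Prop :=
  ∃ F, D.Represents F

open Classical in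
/-- The series Lefschetz invariant `Λ_Σ(D) = f_D(-1) ∈ Ω(G)` (set to `0` if `D` does not have
series Lefschetz invariant). -/
def seriesLefschetzInvariant (D : GCategory G) [IsFiniteCat D.V] : BurnsideRing G :=
  if h : D.HasSeriesLefschetzInvariant then tensorEval (BurnsideRing G) h.choose else 0

/-- The value at `-1` does not depend on the chosen representative of `f_D`. -/
theorem Represents.seriesLefschetzInvariant_eq {D : GCategory G} [IsFiniteCat D.V]
    {F : BurnsideRing G ⊗[ℚ] RatAtNegOne} (h : D.Represents F) :
    D.seriesLefschetzInvariant = tensorEval (BurnsideRing G) F := by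
  have hD : D.HasSeriesLefschetzInvariant := ⟨F, h⟩
  rw [seriesLefschetzInvariant, dif_pos hD,
    tensorToLaurent_injective _ (hD.choose_spec.trans h.symm)]

end GCategory

/-! ### The subgroup decomposition category -/

instance {G : Type u} [Group G] {C : Type u} [Category.{u} C] (F : C ⥤ FinGSet G) (x : C) :
    MulAction G ((F ⋙ FinGSet.forget G).obj x) :=
  inferInstanceAs (MulAction G (F.obj x).carrier)

/-- The action of `g ∈ G` on the category of elements of a functor `F : C ⥤ FinGSet G`:
`g • (x, a) = (x, g • a)` and `g • φ = φ`. -/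
def groAct {G : Type u} [Group G] {C : Type u} [Category.{u} C] (F : C ⥤ FinGSet G) (g : G) :
    (F ⋙ FinGSet.forget G).Elements ⥤ (F ⋙ FinGSet.forget G).Elements where
  obj p := ⟨p.1, g • p.2⟩
  map {p q} f := ⟨f.1,
    (MulActionHom.map_smul' (F.map f.1) g p.2).trans (congrArg (fun b => g • b) f.2)⟩

theorem elements_hom_heq {C : Type u} [Category.{u} C] {F : C ⥤ Type u} {p q p' q' : F.Elements}
    (f : p ⟶ q) (f' : p' ⟶ q') (hp : p = p') (hq : q = q') (h : HEq f.1 f'.1) : HEq f f' := by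
  subst hp hq
  exact heq_of_eq (Subtype.ext (eq_of_heq h))

/-- The Grothendieck construction of a functor `F : C ⥤ FinGSet G`: objects are pairs `(x, a)` with
`a ∈ F x`, morphisms `(x, a) ⟶ (y, b)` are the `φ : x ⟶ y` with `F φ a = b`, and `G` acts by
`g • (x, a) = (x, g • a)` and by `g • φ = φ`. -/
def groConstruction {G : Type u} [Group G] {C : Type u} [Category.{u} C] (F : C ⥤ FinGSet G) :
    GCategory G where
  V := Cat.of (F ⋙ FinGSet.forget G).Elements
  ρ :=
    { toFun := fun g => (groAct F g).toCatHom
      map_one' := by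
        refine Cat.Hom.ext ?_
        have h : ∀ p : (F ⋙ FinGSet.forget G).Elements, (groAct F 1).obj p = p :=
          fun p => Sigma.ext rfl (heq_of_eq (one_smul G p.2))
        exact CategoryTheory.Functor.hext h
          fun p q f => elements_hom_heq _ f (h p) (h q) HEq.rfl
      map_mul' := fun g k => by
        refine Cat.Hom.ext ?_
        have h : ∀ p : (F ⋙ FinGSet.forget G).Elements,
            (groAct F (g * k)).obj p = (groAct F g).obj ((groAct F k).obj p) :=
          fun p => Sigma.ext rfl (heq_of_eq (mul_smul g k p.2))
        exact CategoryTheory.Functor.hext h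
          fun p q f => elements_hom_heq _ ((groAct F g).map ((groAct F k).map f)) (h p) (h q)
            HEq.rfl }

/-- The orbit category `O_S` of a set `S` of subgroups of `G`; its set of objects is `S`. -/
structure OrbitCategory {G : Type u} [Group G] (S : Set (Subgroup G)) : Type u where
  subgroup : Subgroup G
  mem : subgroup ∈ S

/-- Morphisms `H ⟶ K` in the orbit category are the `G`-maps `G/H → G/K`. -/
instance {G : Type u} [Group G] (S : Set (Subgroup G)) : Category.{u} (OrbitCategory S) where
  Hom H K := (G ⧸ H.subgroup) →[G] (G ⧸ K.subgroup)
  id H := MulActionHom.id G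
  comp f g := MulActionHom.comp g f

/-- The inclusion functor from the orbit category to finite `G`-sets, `H ↦ G/H`. -/
def orbitInclusion {G : Type u} [Group G] [Finite G] (S : Set (Subgroup G)) :
    OrbitCategory S ⥤ FinGSet G where
  obj H := FinGSet.of G (G ⧸ H.subgroup)
  map f := f

/-- The subgroup decomposition category `E O_S`: the Grothendieck construction of the inclusion of
the orbit category into finite `G`-sets. -/
def EO {G : Type u} [Group G] [Finite G] (S : Set (Subgroup G)) : GCategory G :=
  groConstruction (orbitInclusion S)

instance {G : Type u} [Group G] [Finite G] (S : Set (Subgroup G)) : IsFiniteCat (EO S).V where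
  finite_obj := by
    have h : Function.Injective (OrbitCategory.subgroup : OrbitCategory S → Subgroup G) := by
      rintro ⟨H, _⟩ ⟨K, _⟩ h
      cases h
      rfl
    have : Finite (OrbitCategory S) := Finite.of_injective _ h
    exact inferInstanceAs (Finite (Σ H : OrbitCategory S, G ⧸ H.subgroup))
  finite_hom := by
    rintro ⟨H, a⟩ ⟨K, b⟩
    have : Finite (H ⟶ K) := by
      refine Finite.of_injective
        (β := G ⧸ H.subgroup → G ⧸ K.subgroup) (fun f => MulActionHom.toFun f) ?_
      exact DFunLike.coe_injective (F := (G ⧸ H.subgroup) →[G] (G ⧸ K.subgroup))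
    exact inferInstanceAs (Finite {f : H ⟶ K // _})

/-! ### The Möbius function -/

open Classical in
/-- The Möbius function of a finite poset. -/
def mobius (P : Type*) [PartialOrder P] [Finite P] (x y : P) : ℚ :=
  letI : Fintype P := Fintype.ofFinite P
  letI : LocallyFiniteOrder P := Fintype.toLocallyFiniteOrder
  IncidenceAlgebra.mu ℚ x y

end

/-!
The category `EO S` is a preorder: a `G`-map `G/H → G/K` is determined by where it sends one point
`a`, and a `G`-map sending `a` to `b` exists precisely when the stabilizer of `a` is contained in
that of `b`. As `S` is closed under conjugation, taking stabilizers maps the objects of `EO S` to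
`S`, and each `L ∈ S` is hit by exactly `|G : L|` objects (`sum_isotropy`).

An element of `G` that fixes the first vertex of a simplex fixes the whole simplex. Hence every
`G`-orbit of nondegenerate `n`-simplices has a representative starting at `(H, eH)` for a unique
`H ∈ S`, it is isomorphic to `G/H`, and `[D_n] = ∑_H w_n(H) [G/H]`, where `w_n(H)` is the number of
nondegenerate `n`-simplices starting at `(H, eH)` (`burnsideClass_simplex`).

Choosing the second vertex first gives `w_0 = 1` and
`w_{n+1}(H) = ∑_{L ≥ H} |G : L| w_n(L) - w_n(H)`, so the generating functions
`P_H = ∑_n w_n(H) tⁿ` satisfy `(1 + t - |G : H| t) P_H = 1 + t ∑_{L > H} |G : L| P_L`. The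
coefficient on the left has the nonzero value `|G : H|` at `t = -1`. By downward induction on `H`,
`P_H` is a rational function without a pole at `-1`, and `-|G : H| P_H(-1)` satisfies the recursion
`μ(H, ∞) = -(1 + ∑_{L > H} μ(L, ∞))` of the Möbius function of `S₊` (`exists_rat_chainSeries`).
-/

noncomputable section

/-! ### Additivity of Burnside classes -/

section BurnsideClass

variable {G : Type u} [Group G]

theorem burnsideClass_congr {X Y : FinGSet G} (e : X.carrier ≃ Y.carrier)
    (he : ∀ (g : G) (x : X.carrier), e (g • x) = g • e x) :
    burnsideClass X = burnsideClass Y := by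
  have h : (Quotient.mk (FinGSet.isoSetoid G) X) = Quotient.mk _ Y := Quotient.sound ⟨e, he⟩
  unfold burnsideClass
  rw [h]

theorem burnsideClass_sum (X Y : FinGSet G) :
    burnsideClass (X.sum Y) = burnsideClass X + burnsideClass Y := by
  unfold burnsideClass
  rw [← TensorProduct.tmul_add, ← map_add]
  congr 1
  rw [Ideal.Quotient.eq, ← sub_sub]
  exact Ideal.subset_span ⟨(X, Y), rfl⟩

/-- Since `∅ ⊔ ∅ = ∅`, the class of the empty `G`-set vanishes. -/
theorem burnsideClass_of_isEmpty (X : FinGSet G) [IsEmpty X.carrier] : burnsideClass X = 0 := by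
  have h : burnsideClass (X.sum X) = burnsideClass X :=
    burnsideClass_congr (Equiv.sumEmpty X.carrier X.carrier)
      (by rintro g (x | x) <;> exact isEmptyElim x)
  rwa [burnsideClass_sum, add_eq_left] at h

theorem burnsideClass_sigma (ι : Type u) [Fintype ι] (X : ι → Type u)
    [∀ i, Finite (X i)] [∀ i, MulAction G (X i)] :
    burnsideClass (FinGSet.of G (Σ i, X i)) = ∑ i, burnsideClass (FinGSet.of G (X i)) := by
  refine Fintype.induction_empty_option (P := fun ι _ => ∀ (X : ι → Type u)
    [∀ i, Finite (X i)] [∀ i, MulAction G (X i)],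
    burnsideClass (FinGSet.of G (Σ i, X i)) = ∑ i, burnsideClass (FinGSet.of G (X i)))
    ?_ ?_ ?_ ι X
  · intro α β _ e ih X _ _
    let _ := Fintype.ofEquiv β e.symm
    rw [← e.sum_comp, ← ih (fun i => X (e i))]
    exact (burnsideClass_congr (X := FinGSet.of G (Σ i, X (e i))) (Y := FinGSet.of G (Σ i, X i))
      (Equiv.sigmaCongrLeft e) (fun _ _ => rfl)).symm
  · intro X _ _
    have : IsEmpty (FinGSet.of G (Σ i, X i)).carrier := ⟨fun x => x.1.elim⟩
    rw [burnsideClass_of_isEmpty]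
    simp
  · intro α _ ih X _ _
    rw [Fintype.sum_option, ← ih (fun i => X (some i)), ← burnsideClass_sum]
    refine burnsideClass_congr
      { toFun := fun p => match p with
          | ⟨none, x⟩ => Sum.inl x
          | ⟨some i, x⟩ => Sum.inr ⟨i, x⟩
        invFun := fun p => match p with
          | Sum.inl x => ⟨none, x⟩
          | Sum.inr x => ⟨some x.1, x.2⟩
        left_inv := by rintro ⟨_ | i, x⟩ <;> rfl
        right_inv := by rintro (x | x) <;> rfl } ?_
    rintro g ⟨_ | i, x⟩ <;> rfl

/-- A finite `G`-set is the disjoint union of the orbits of any family of orbit representatives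
`r i`, and the orbit of `r i` is `G/K i` where `K i` is its stabilizer. -/
theorem burnsideClass_eq_sum_of_representatives {X : Type u} [Finite X] [MulAction G X]
    {ι : Type u} [Fintype ι] (r : ι → X) (K : ι → Subgroup G) [∀ i, Finite (G ⧸ K i)]
    (hK : ∀ i, MulAction.stabilizer G (r i) = K i)
    (hinj : ∀ i j (g : G), g • r i = r j → i = j) (hsurj : ∀ x, ∃ i, ∃ g : G, g • r i = x) :
    burnsideClass (FinGSet.of G X) = ∑ i, burnsideClass (FinGSet.of G (G ⧸ K i)) := by
  obtain rfl : (fun i => MulAction.stabilizer G (r i)) = K := funext hK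
  rw [← burnsideClass_sigma]
  refine (burnsideClass_congr (X := FinGSet.of G (Σ i, G ⧸ MulAction.stabilizer G (r i)))
    (Y := FinGSet.of G X) (Equiv.ofBijective
      (fun p => MulAction.ofQuotientStabilizer G (r p.1) p.2) ⟨?_, ?_⟩) ?_).symm
  · rintro ⟨i, a⟩ ⟨j, b⟩ h
    induction a using QuotientGroup.induction_on with | H a =>
    induction b using QuotientGroup.induction_on with | H b =>
    have h' : a • r i = b • r j := h
    obtain rfl : i = j := hinj i j (b⁻¹ * a) (by rw [mul_smul, h', inv_smul_smul])
    congr 1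
    exact MulAction.injective_ofQuotientStabilizer G (r i) h
  · intro x
    obtain ⟨i, g, h⟩ := hsurj x
    exact ⟨⟨i, (g : G ⧸ MulAction.stabilizer G (r i))⟩, h⟩
  · rintro g ⟨i, a⟩
    exact MulAction.ofQuotientStabilizer_smul G (r i) g a

end BurnsideClass

/-! ### Weighted chain counts in a finite poset -/

section WeightedChainCount

variable {P : Type*}

open Classical in
/-- The numbers `wₙ(x)` with `w₀(x) = 1` and `wₙ₊₁(x) = ∑_{y ≥ x} m(y) wₙ(y) - wₙ(x)`. If `P` is
the poset of isomorphism classes of a finite preorder and `m(y)` is the number of elements in the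
class `y`, then `wₙ(x)` is the number of chains `x₀ ≤ x₁ ≤ ⋯ ≤ xₙ` of elements of the preorder
with `xᵢ ≠ xᵢ₊₁` that start at a given element of the class `x`. -/
def weightedChainCount [Preorder P] [Fintype P] (m : P → ℚ) : ℕ → P → ℚ
  | 0, _ => 1
  | n + 1, x => (∑ y with x ≤ y, m y * weightedChainCount m n y) - weightedChainCount m n x

/-- The generating function `∑ₙ wₙ(x) tⁿ` of the weighted chain counts. -/
def chainSeries [Preorder P] [Fintype P] (m : P → ℚ) (x : P) : PowerSeries ℚ :=
  PowerSeries.mk fun n => weightedChainCount m n x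

variable [PartialOrder P] [Fintype P]

open Classical in
theorem sum_le_eq_add_sum_lt {M : Type*} [AddCommMonoid M] (f : P → M) (x : P) :
    ∑ y with x ≤ y, f y = f x + ∑ y with x < y, f y := by
  have h : (Finset.univ.filter fun y => x ≤ y) = insert x (Finset.univ.filter fun y => x < y) := by
    ext y
    simp [le_iff_eq_or_lt, eq_comm]
  rw [h, Finset.sum_insert (by simp)]

open Classical in
/-- The recursion for the chain counts, with the term for `x` itself moved to the left. -/
theorem chainSeries_eq (m : P → ℚ) (x : P) :
    (1 + PowerSeries.X - PowerSeries.C (m x) * PowerSeries.X) * chainSeries m x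
      = 1 + PowerSeries.X * ∑ y with x < y, PowerSeries.C (m y) * chainSeries m y := by
  have h : chainSeries m x = 1 + PowerSeries.X *
      (∑ y with x ≤ y, PowerSeries.C (m y) * chainSeries m y - chainSeries m x) := by
    ext n
    cases n with
    | zero => simp [chainSeries, weightedChainCount]
    | succ n =>
      simp [chainSeries, weightedChainCount, PowerSeries.coeff_one, PowerSeries.coeff_succ_X_mul]
  rw [sum_le_eq_add_sum_lt] at h
  linear_combination h

open Classical in
theorem mobius_eq_neg_sum {x y : P} (h : x ≠ y) :
    mobius P x y = -∑ z with x < z ∧ z ≤ y, mobius P z y := by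
  let _ : LocallyFiniteOrder P := @Fintype.toLocallyFiniteOrder P _ (Fintype.ofFinite P) _ _
  have hs : (Finset.univ.filter fun z => x < z ∧ z ≤ y) = Finset.Ioc x y := by
    ext z
    simp
  rw [hs]
  exact IncidenceAlgebra.mu_eq_neg_sum_Ioc_of_ne (𝕜 := ℚ) h

open Classical in
theorem mobius_self (x : P) : mobius P x x = 1 := by
  let _ : LocallyFiniteOrder P := @Fintype.toLocallyFiniteOrder P _ (Fintype.ofFinite P) _ _
  exact IncidenceAlgebra.mu_self (𝕜 := ℚ) x

open Classical in
theorem mobius_withTop_top (x : P) :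
    mobius (WithTop P) x ⊤ = -(1 + ∑ y with x < y, mobius (WithTop P) (y : WithTop P) ⊤) := by
  rw [mobius_eq_neg_sum WithTop.coe_ne_top, Finset.sum_congr
    (s₂ := insert ⊤ ((Finset.univ.filter fun y => x < y).map
      ⟨WithTop.some, WithTop.coe_injective⟩))
    (by ext z; induction z using WithTop.recTopCoe <;> simp) (fun _ _ => rfl),
    Finset.sum_insert (by simp), Finset.sum_map, mobius_self]
  rfl

theorem evalNegOne_algebraMap (p : ℚ[X]) :
    evalNegOne (algebraMap ℚ[X] RatAtNegOne p) = p.eval (-1) := by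
  simp [evalNegOne]

theorem ratToLaurent_algebraMap (p : ℚ[X]) :
    ratToLaurent (algebraMap ℚ[X] RatAtNegOne p)
      = HahnSeries.ofPowerSeries ℤ ℚ (p : PowerSeries ℚ) :=
  IsLocalization.lift_eq (M := idealTAddOne.primeCompl) isUnit_polyToLaurent p

open Classical in
/-- The generating function of the weighted chain counts is a rational function without a pole
at `-1`, where its value is a Möbius number. -/
theorem exists_rat_chainSeries (m : P → ℚ) (hm : ∀ x, m x ≠ 0) (x : P) :
    ∃ r : RatAtNegOne, ratToLaurent r = HahnSeries.ofPowerSeries ℤ ℚ (chainSeries m x) ∧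
      evalNegOne r = -mobius (WithTop P) (x : WithTop P) ⊤ / m x := by
  induction x using (Finite.to_wellFoundedGT (α := P)).induction with | _ x ih =>
  have ih' : ∀ y, ∃ r : RatAtNegOne, x < y →
      ratToLaurent r = HahnSeries.ofPowerSeries ℤ ℚ (chainSeries m y) ∧
        evalNegOne r = -mobius (WithTop P) (y : WithTop P) ⊤ / m y := fun y => by
    by_cases h : x < y
    · obtain ⟨r, hr⟩ := ih y h
      exact ⟨r, fun _ => hr⟩
    · exact ⟨0, fun h' => absurd h' h⟩
  choose r hr using ih'
  -- The equation `q · z = s` below is the recursion for `chainSeries m x`; solving it for `z` is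
  -- possible because `q(-1) = m x` is nonzero.
  let q : ℚ[X] := 1 + Polynomial.X - Polynomial.C (m x) * Polynomial.X
  have hq : q.eval (-1) = m x := by simp [q]
  let s : RatAtNegOne := 1 + algebraMap ℚ[X] RatAtNegOne Polynomial.X *
    ∑ y with x < y, algebraMap ℚ[X] RatAtNegOne (Polynomial.C (m y)) * r y
  have hu : IsUnit (algebraMap ℚ[X] RatAtNegOne q) :=
    IsLocalization.map_units RatAtNegOne
      (⟨q, fun h => hm x (hq ▸ (mem_idealTAddOne q).1 h)⟩ : idealTAddOne.primeCompl)
  obtain ⟨z, hz⟩ : ∃ z, algebraMap ℚ[X] RatAtNegOne q * z = s := hu.dvd.imp fun _ h => h.symm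
  refine ⟨z, ?_, ?_⟩
  · have h1 : ratToLaurent s = HahnSeries.ofPowerSeries ℤ ℚ
        (1 + PowerSeries.X * ∑ y with x < y, PowerSeries.C (m y) * chainSeries m y) := by
      simp only [s, map_add, map_one, map_mul, map_sum, ratToLaurent_algebraMap,
        Polynomial.coe_X, Polynomial.coe_C]
      congr 2
      refine Finset.sum_congr rfl fun y hy => ?_
      rw [(hr y (Finset.mem_filter.1 hy).2).1]
    rw [← hz, map_mul, ratToLaurent_algebraMap, ← chainSeries_eq, map_mul] at h1
    have h2 : (q : PowerSeries ℚ)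
        = 1 + PowerSeries.X - PowerSeries.C (m x) * PowerSeries.X := by simp [q]
    rw [h2] at h1
    refine mul_left_cancel₀ (fun h0 => ?_) h1
    rw [← h2, ← ratToLaurent_algebraMap] at h0
    exact (hu.map ratToLaurent).ne_zero h0
  · have h1 : evalNegOne s = -mobius (WithTop P) (x : WithTop P) ⊤ := by
      simp only [s, map_add, map_one, map_mul, map_sum, evalNegOne_algebraMap,
        Polynomial.eval_X, Polynomial.eval_C]
      rw [mobius_withTop_top, neg_neg, neg_one_mul, ← Finset.sum_neg_distrib]
      congr 1
      refine Finset.sum_congr rfl fun y hy => ?_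
      rw [(hr y (Finset.mem_filter.1 hy).2).2, mul_div_cancel₀ _ (hm y), neg_neg]
    rw [← h1, ← hz, map_mul, evalNegOne_algebraMap, hq, mul_div_cancel_left₀ _ (hm x)]

end WeightedChainCount

/-! ### Chains in thin `G`-categories -/

section Chains

/-- The sequences `x₀, …, xₙ` starting at `x₀ = x` with consecutive terms related by `R`. -/
def RelChain {V : Type*} (R : V → V → Prop) (n : ℕ) (x : V) : Type _ :=
  {f : Fin (n + 1) → V // f 0 = x ∧ ∀ i : Fin n, R (f i.castSucc) (f i.succ)}

variable {V : Type*} (R : V → V → Prop)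

instance [Finite V] (n : ℕ) (x : V) : Finite (RelChain R n x) :=
  inferInstanceAs (Finite {_f : Fin (n + 1) → V // _})

theorem card_relChain_zero (x : V) : Nat.card (RelChain R 0 x) = 1 := by
  rw [Nat.card_eq_one_iff_unique]
  refine ⟨⟨fun f g => Subtype.ext (funext fun i => ?_)⟩,
    ⟨⟨fun _ => x, rfl, fun i : Fin 0 => i.elim0⟩⟩⟩
  obtain rfl : i = 0 := Fin.fin_one_eq_zero i
  rw [f.2.1, g.2.1]

/-- Removing the first term of a chain. -/
def relChainSuccEquiv (n : ℕ) (x : V) :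
    RelChain R (n + 1) x ≃ Σ y : {y // R x y}, RelChain R n y where
  toFun f := ⟨⟨f.1 1, by simpa [f.2.1] using f.2.2 0⟩, fun i => f.1 i.succ, rfl,
    fun i => f.2.2 i.succ⟩
  invFun p := ⟨Fin.cons x p.2.1, rfl, fun i => by
    cases i using Fin.cases with
    | zero => simpa [p.2.2.1] using p.1.2
    | succ i => simpa using p.2.2.2 i⟩
  left_inv f := Subtype.ext (funext fun i => by
    cases i using Fin.cases with
    | zero => exact f.2.1.symm
    | succ i => rfl)
  right_inv := by
    rintro ⟨⟨y, hy⟩, f, hy', hf⟩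
    change f 0 = y at hy'
    subst hy'
    rfl

open Classical in
theorem card_relChain_succ [Fintype V] (n : ℕ) (x : V) :
    Nat.card (RelChain R (n + 1) x) = ∑ y with R x y, Nat.card (RelChain R n y) := by
  rw [Nat.card_congr (relChainSuccEquiv R n x), Nat.card_sigma]
  exact (Finset.sum_subtype _ (by simp) (fun y => Nat.card (RelChain R n y))).symm

theorem functor_ext_of_subsingleton_hom {C D : Type*} [Category* C] [Category* D]
    [∀ x y : D, Subsingleton (x ⟶ y)] {F F' : C ⥤ D} (h : ∀ x, F.obj x = F'.obj x) : F = F' :=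
  CategoryTheory.Functor.ext h fun _ _ _ => Subsingleton.elim _ _

variable {G : Type u} [Group G]

/-- In a thin category a nondegenerate simplex is determined by its vertices: they form a chain
of distinct consecutive objects with a morphism from each to the next. -/
def simplexEquivRelChain (D : GCategory G) [∀ x y : D.V, Subsingleton (x ⟶ y)] (n : ℕ)
    (x : D.V) : {σ : D.Simplex n // σ.1.obj 0 = x} ≃
      RelChain (fun x y : D.V => Nonempty (x ⟶ y) ∧ x ≠ y) n x where
  toFun σ := ⟨σ.1.1.obj, σ.2, fun i => ⟨⟨σ.1.1.map' i (i + 1)⟩, fun h =>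
    σ.1.2 i i.2 ⟨h, Subsingleton.elim _ _⟩⟩⟩
  invFun f := ⟨⟨ComposableArrows.mkOfObjOfMapSucc f.1 fun i => (f.2.2 i).1.some,
    fun i hi h => (f.2.2 ⟨i, hi⟩).2 h.1⟩, f.2.1⟩
  left_inv σ := Subtype.ext (Subtype.ext (functor_ext_of_subsingleton_hom fun _ => rfl))
  right_inv f := rfl

end Chains

/-! ### The subgroup decomposition category is a preorder -/

section EO

variable {G : Type u} [Group G]

theorem stabilizer_quotient_mk (H : Subgroup G) (x : G) :
    MulAction.stabilizer G (x : G ⧸ H) = MulAut.conj x • H := by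
  have h : (x : G ⧸ H) = x • ((1 : G) : G ⧸ H) := by simp
  rw [h, MulAction.stabilizer_smul_eq_stabilizer_map_conj, MulAction.stabilizer_quotient]
  rfl

/-- The orbit `G/H` maps to any `G`-set through each pair `(a, b)` for which the stabilizer of `a`
fixes `b`. -/
theorem exists_hom_quotient {X : Type*} [MulAction G X] {H : Subgroup G} (a : G ⧸ H) (b : X)
    (h : MulAction.stabilizer G a ≤ MulAction.stabilizer G b) : ∃ f : (G ⧸ H) →[G] X, f a = b := by
  induction a using QuotientGroup.induction_on with | H x =>
  refine ⟨⟨Quotient.lift (fun y : G => y • x⁻¹ • b) fun y z hyz => ?_, ?_⟩, smul_inv_smul x b⟩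
  · have hyz' : y⁻¹ * z ∈ H := QuotientGroup.leftRel_apply.1 hyz
    have hmem : x * (y⁻¹ * z) * x⁻¹ ∈ MulAction.stabilizer G b := h <| by
      rw [MulAction.mem_stabilizer_iff, MulAction.Quotient.smul_mk, QuotientGroup.eq]
      simpa [mul_assoc] using H.inv_mem hyz'
    have h1 := MulAction.mem_stabilizer_iff.1 hmem
    calc y • x⁻¹ • b = y • x⁻¹ • (x * (y⁻¹ * z) * x⁻¹) • b := by rw [h1]
      _ = z • x⁻¹ • b := by simp [smul_smul, mul_assoc]
  · intro g y
    induction y using QuotientGroup.induction_on with | H y =>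
    exact mul_smul g y _

theorem sum_comp_quotient_mk {M : Type*} [AddCommMonoid M] (H : Subgroup G) [Fintype G]
    [Fintype (G ⧸ H)] (f : G ⧸ H → M) :
    ∑ x : G, f x = Nat.card H • ∑ a, f a := by
  classical
  rw [← Finset.sum_fiberwise Finset.univ (fun x : G => (x : G ⧸ H)), Finset.smul_sum]
  refine Finset.sum_congr rfl fun a _ => ?_
  rw [Finset.sum_congr rfl (g := fun _ => f a) (fun x hx => by rw [(Finset.mem_filter.1 hx).2]),
    Finset.sum_const]
  congr 1
  have h := QuotientGroup.card_preimage_mk H {a}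
  rw [Nat.card_unique (α := ({a} : Set (G ⧸ H))), mul_one] at h
  rw [← h, ← Nat.subtype_card _ (fun x => Finset.mem_filter_univ x)]
  rfl

variable [Finite G] {S : Set (Subgroup G)}

/-- The isotropy group of the object `(H, a)`, that is, the stabilizer of `a`. -/
def isotropy (hS : ∀ H ∈ S, ∀ g : G, MulAut.conj g • H ∈ S) (p : (EO S).V) : S :=
  ⟨MulAction.stabilizer G (show G ⧸ p.1.subgroup from p.2), by
    obtain ⟨H, a⟩ := p
    induction a using QuotientGroup.induction_on with | H a =>
    exact stabilizer_quotient_mk H.subgroup a ▸ hS _ H.mem a⟩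

/-- A `G`-map out of `G/H` is determined by its value at one point, so `EO S` is thin. -/
instance subsingleton_hom (p q : (EO S).V) : Subsingleton (p ⟶ q) := by
  refine ⟨fun f g => Subtype.ext (MulActionHom.ext fun a => ?_)⟩
  obtain ⟨x, rfl⟩ := MulAction.exists_smul_eq G (show G ⧸ p.1.subgroup from p.2) a
  refine (MulActionHom.map_smul' f.1 x _).trans (Eq.trans ?_ (MulActionHom.map_smul' g.1 x _).symm)
  exact congrArg (x • ·) (f.2.trans g.2.symm)

/-- Together with `subsingleton_hom`, this identifies `EO S` with the preorder on its objects that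
is pulled back from the inclusion order on `S` along `isotropy`. -/
theorem nonempty_hom_iff (hS : ∀ H ∈ S, ∀ g : G, MulAut.conj g • H ∈ S) (p q : (EO S).V) :
    Nonempty (p ⟶ q) ↔ isotropy hS p ≤ isotropy hS q := by
  constructor
  · rintro ⟨f⟩ x hx
    have hx' : x • (show G ⧸ p.1.subgroup from p.2) = p.2 := hx
    have h := MulActionHom.map_smul' f.1 x (show G ⧸ p.1.subgroup from p.2)
    rw [hx'] at h
    have hf : f.1.toFun p.2 = q.2 := f.2
    rw [hf] at h
    exact h.symm
  · intro h
    obtain ⟨f, hf⟩ := exists_hom_quotient (H := p.1.subgroup) p.2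
      (show G ⧸ q.1.subgroup from q.2) h
    exact ⟨⟨f, hf⟩⟩

/-- Each `L ∈ S` is the isotropy group of exactly `|G : L|` objects of `EO S`, in the form of an
identity for sums of functions of the isotropy group. -/
theorem sum_isotropy (hS : ∀ H ∈ S, ∀ g : G, MulAut.conj g • H ∈ S) [Fintype (EO S).V]
    [Fintype S] (F : S → ℚ) :
    ∑ p, F (isotropy hS p) = ∑ L : S, ((L : Subgroup G).index : ℚ) * F L := by
  classical
  let _ := Fintype.ofFinite G
  let c : G → S → S := fun x H => ⟨MulAut.conj x • (H : Subgroup G), hS _ H.2 x⟩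
  have hc : ∀ x, Function.Bijective (c x) := fun x =>
    Function.Injective.bijective_of_finite fun H K h =>
      Subtype.ext (MulAction.injective (MulAut.conj x) (congrArg Subtype.val h))
  have hcard : ∀ x H, Nat.card (c x H : Subgroup G) = Nat.card (H : Subgroup G) := fun x H =>
    (Nat.card_congr (Subgroup.equivSMul (MulAut.conj x) (H : Subgroup G)).toEquiv).symm
  let _ : ∀ H : Subgroup G, Fintype (G ⧸ H) := fun H => Fintype.ofFinite _
  have hpos : ∀ H : Subgroup G, (Nat.card H : ℚ) ≠ 0 := fun H => by
    exact_mod_cast Nat.card_pos.ne'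
  let e : (Σ H : S, G ⧸ (H : Subgroup G)) ≃ (EO S).V :=
    { toFun := fun p => ⟨⟨p.1.1, p.1.2⟩, p.2⟩
      invFun := fun p => ⟨⟨p.1.1, p.1.2⟩, p.2⟩
      left_inv := fun _ => rfl
      right_inv := fun _ => rfl }
  calc ∑ p, F (isotropy hS p)
      = ∑ H : S, ∑ a : G ⧸ (H : Subgroup G), F (isotropy hS (e ⟨H, a⟩)) := by
        rw [← e.sum_comp, Fintype.sum_sigma]
    -- Replacing a sum over `G/H` by a sum over `G` costs a factor `|H|`, which is invariant under
    -- conjugation; so for each `x` the sum over `S` may be reindexed by conjugation with `x`.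
    _ = ∑ H : S, ∑ x : G, F (c x H) / Nat.card (H : Subgroup G) := by
        refine Finset.sum_congr rfl fun H _ => ?_
        rw [← Finset.sum_div, eq_div_iff (hpos _), mul_comm, ← nsmul_eq_mul,
          ← sum_comp_quotient_mk]
        refine Finset.sum_congr rfl fun x _ => congrArg F (Subtype.ext ?_)
        exact stabilizer_quotient_mk _ _
    _ = ∑ x : G, ∑ H : S, F (c x H) / Nat.card (c x H : Subgroup G) := by
        rw [Finset.sum_comm]
        simp only [hcard]
    _ = ∑ x : G, ∑ L : S, F L / Nat.card (L : Subgroup G) :=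
        Finset.sum_congr rfl fun x _ =>
          (hc x).sum_comp fun L : S => F L / (Nat.card (L : Subgroup G) : ℚ)
    _ = ∑ L : S, ((L : Subgroup G).index : ℚ) * F L := by
        rw [Finset.sum_const, Finset.smul_sum]
        refine Finset.sum_congr rfl fun L _ => ?_
        have h := Subgroup.card_mul_index (L : Subgroup G)
        have h' := hpos (L : Subgroup G)
        rw [Finset.card_univ, ← Nat.card_eq_fintype_card, ← h, nsmul_eq_mul]
        push_cast
        field_simp

/-- The number of nondegenerate simplices of `EO S` with first vertex `p`. -/
theorem card_simplex_eq_weightedChainCount [Fintype S]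
    (hS : ∀ H ∈ S, ∀ g : G, MulAut.conj g • H ∈ S) (n : ℕ) (p : (EO S).V) :
    (Nat.card {σ : (EO S).Simplex n // σ.1.obj 0 = p} : ℚ)
      = weightedChainCount (fun L : S => ((L : Subgroup G).index : ℚ)) n (isotropy hS p) := by
  classical
  have := IsFiniteCat.finite_obj (C := (EO S).V)
  let _ := Fintype.ofFinite (EO S).V
  rw [Nat.card_congr (simplexEquivRelChain (EO S) n p)]
  induction n generalizing p with
  | zero => rw [card_relChain_zero, Nat.cast_one, weightedChainCount]
  | succ n ih =>
    -- The objects above `p` are `p` and the possible second vertices of a chain starting at `p`;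
    -- objects isomorphic to `p` but distinct from it are among the latter.
    have hset : (Finset.univ.filter fun q => isotropy hS p ≤ isotropy hS q)
        = insert p (Finset.univ.filter fun q => Nonempty (p ⟶ q) ∧ p ≠ q) := by
      ext q
      by_cases h : p = q
      · simp [h]
      · simp [h, Ne.symm h, nonempty_hom_iff hS]
    have h := sum_isotropy hS fun L => if isotropy hS p ≤ L then
      weightedChainCount (fun L : S => ((L : Subgroup G).index : ℚ)) n L else 0
    rw [← Finset.sum_filter, hset, Finset.sum_insert (by simp)] at h
    rw [card_relChain_succ, Nat.cast_sum, weightedChainCount, Finset.sum_filter _ (fun L => _ * _)]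
    simp only [ih]
    simp only [mul_ite, mul_zero] at h
    rw [← h, add_sub_cancel_left]
    congr!

theorem mem_isotropy_iff (hS : ∀ H ∈ S, ∀ g : G, MulAut.conj g • H ∈ S) (p : (EO S).V) (g : G) :
    g ∈ (isotropy hS p : Subgroup G) ↔ ((EO S).act g).obj p = p :=
  ⟨fun h => Sigma.ext rfl (heq_of_eq h), fun h => eq_of_heq (Sigma.mk.inj h).2⟩

/-- An element of `G` that fixes the first vertex of a simplex fixes the simplex, because the
isotropy groups increase along the simplex. -/
theorem simplex_smul_eq_of_vertex (hS : ∀ H ∈ S, ∀ g : G, MulAut.conj g • H ∈ S) {n : ℕ} (g : G)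
    (σ : (EO S).Simplex n) (h : ((EO S).act g).obj (σ.1.obj 0) = σ.1.obj 0) : g • σ = σ := by
  refine Subtype.ext (functor_ext_of_subsingleton_hom fun i => (mem_isotropy_iff hS _ g).1 ?_)
  exact (nonempty_hom_iff hS _ _).1 ⟨σ.1.map (homOfLE (Fin.zero_le i))⟩
    ((mem_isotropy_iff hS _ g).2 h)

/-- The nondegenerate `n`-simplices of `EO S` with first vertex `(H, eH)`, for `H ∈ S`, represent
the `G`-orbits, and the isotropy group of such a simplex is `H`. -/
theorem burnsideClass_simplex [Fintype S]
    (hS : ∀ H ∈ S, ∀ g : G, MulAut.conj g • H ∈ S) (n : ℕ) :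
    burnsideClass (FinGSet.of G ((EO S).Simplex n)) =
      ∑ H : S, weightedChainCount (fun L : S => ((L : Subgroup G).index : ℚ)) n H •
        burnsideClass (FinGSet.of G (G ⧸ (H : Subgroup G))) := by
  let p : S → (EO S).V := fun H => ⟨⟨H.1, H.2⟩, ((1 : G) : G ⧸ (H : Subgroup G))⟩
  have hp : ∀ H, isotropy hS (p H) = H := fun H =>
    Subtype.ext (MulAction.stabilizer_quotient (H : Subgroup G))
  let ι := Σ H : S, {σ : (EO S).Simplex n // σ.1.obj 0 = p H}
  let _ : ∀ H : S, Fintype {σ : (EO S).Simplex n // σ.1.obj 0 = p H} :=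
    fun H => Fintype.ofFinite _
  rw [burnsideClass_eq_sum_of_representatives (ι := ι) (fun i => i.2.1) (fun i => i.1)]
  · rw [Fintype.sum_sigma]
    refine Finset.sum_congr rfl fun H _ => ?_
    refine (Finset.sum_const (burnsideClass (FinGSet.of G (G ⧸ (H : Subgroup G))))).trans ?_
    rw [Finset.card_univ, ← Nat.card_eq_fintype_card, ← Nat.cast_smul_eq_nsmul ℚ,
      card_simplex_eq_weightedChainCount hS, hp]
  · rintro ⟨H, σ, hσ⟩
    ext g
    have h := mem_isotropy_iff hS (p H) g
    rw [hp] at h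
    rw [h, MulAction.mem_stabilizer_iff]
    refine ⟨fun hg => ?_, fun hg => simplex_smul_eq_of_vertex hS g σ (hσ.symm ▸ hg)⟩
    exact hσ ▸ congrArg (fun τ : (EO S).Simplex n => τ.1.obj 0) hg
  · rintro ⟨H, σ, hσ⟩ ⟨K, τ, hτ⟩ g h
    have h0 : ((EO S).act g).obj (p H) = p K :=
      (congrArg ((EO S).act g).obj hσ).symm.trans
        ((congrArg (fun τ : (EO S).Simplex n => τ.1.obj 0) h).trans hτ)
    obtain rfl : H = K := Subtype.ext (congrArg (fun q : (EO S).V => q.1.subgroup) h0)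
    have h1 : g • σ = σ := simplex_smul_eq_of_vertex hS g σ (hσ.symm ▸ h0)
    obtain rfl : σ = τ := h1.symm.trans h
    rfl
  · intro σ
    obtain ⟨x, hx⟩ := QuotientGroup.mk_surjective
      (show G ⧸ (σ.1.obj 0).1.subgroup from (σ.1.obj 0).2)
    refine ⟨⟨⟨(σ.1.obj 0).1.subgroup, (σ.1.obj 0).1.mem⟩, x⁻¹ • σ, ?_⟩, x, smul_inv_smul x σ⟩
    refine Sigma.ext rfl (heq_of_eq ?_)
    have h1 : x⁻¹ • (show G ⧸ (σ.1.obj 0).1.subgroup from (σ.1.obj 0).2)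
        = ((1 : G) : G ⧸ (σ.1.obj 0).1.subgroup) := by
      rw [← hx, MulAction.Quotient.smul_coe, smul_eq_mul, inv_mul_cancel]
    exact h1

end EO

/-! ### The series Lefschetz invariant -/

theorem theoremA {G : Type u} [Group G] [Finite G] (S : Set (Subgroup G))
    (hS : ∀ H ∈ S, ∀ g : G, MulAut.conj g • H ∈ S) :
    (EO S).HasSeriesLefschetzInvariant ∧
      (EO S).seriesLefschetzInvariant =
        ∑ᶠ H : S, (-mobius (WithTop S) (H : WithTop S) ⊤ / ((H : Subgroup G).index : ℚ)) •
          burnsideClass (FinGSet.of G (G ⧸ (H : Subgroup G))) := by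
  let _ : Fintype S := Fintype.ofFinite S
  choose r hr hr' using exists_rat_chainSeries (fun L : S => ((L : Subgroup G).index : ℚ))
    (fun L => Nat.cast_ne_zero.2 Subgroup.index_ne_zero_of_finite)
  have hF : (EO S).Represents
      (∑ H : S, burnsideClass (FinGSet.of G (G ⧸ (H : Subgroup G))) ⊗ₜ r H) := by
    have hterm : ∀ H : S, tensorToLaurent (BurnsideRing G)
        (burnsideClass (FinGSet.of G (G ⧸ (H : Subgroup G))) ⊗ₜ r H)
        = HahnSeries.ofPowerSeries ℤ (BurnsideRing G) (PowerSeries.mk fun n =>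
            weightedChainCount (fun L : S => ((L : Subgroup G).index : ℚ)) n H •
              burnsideClass (FinGSet.of G (G ⧸ (H : Subgroup G)))) := fun H => by
      ext k
      have h : (tensorToLaurent (BurnsideRing G)
          (burnsideClass (FinGSet.of G (G ⧸ (H : Subgroup G))) ⊗ₜ r H)).coeff k
          = (ratToLaurent (r H)).coeff k •
            burnsideClass (FinGSet.of G (G ⧸ (H : Subgroup G))) := rfl
      rw [h, hr]
      simp only [PowerSeries.coeff_coe, chainSeries, PowerSeries.coeff_mk]
      -- The coefficients of negative index vanish on both sides.
      split_ifs
      · rw [zero_smul]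
      · rfl
    rw [GCategory.Represents, map_sum, Finset.sum_congr rfl fun H _ => hterm H, ← map_sum]
    congr 1
    ext n
    simp [GCategory.powerSeries, burnsideClass_simplex hS]
  refine ⟨⟨_, hF⟩, ?_⟩
  rw [hF.seriesLefschetzInvariant_eq, map_sum, finsum_eq_sum_of_fintype]
  refine Finset.sum_congr rfl fun H _ => ?_
  rw [← hr']
  rfl

end
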